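/- Let $T$ be a finite tree with vertex set $V(T)$, in which every edge $\{a,b\}$ carries two integer labels $\lambda_{a,b}\ge 2$ and $\lambda_{b,a}\ge 2$. Then the tree product of infinite cyclic groups associated with this labelled tree, that is, the group $$G(T)=\langle\, a\in V(T)\;:\; a^{\lambda_{a,b}}=b^{\lambda_{b,a}}\ \text{ for every edge } \{a,b\} \text{ of } T \,\rangle,$$ is a Garside group. Here a monoid $M$ is called Garside if $1$ is its only invertible element, it is left and right cancellative, any two of its elements have a right lcm (a common right multiple of which every common right multiple is a right multiple) and, symmetrically, a left lcm, and $M$ has a Garside element, i.e. an element $\Delta$ whose left divisors and right divisors are the same elements, are finitely many, and generate $M$. A group is called a Garside group if it is isomorphic to the enveloping group of some Garside monoid $M$, i.e. to the group generated by the elements of $M$ subject to all relations $bc=d$ that hold in $M$. -/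

import Mathlib

universe u

/-- `d` is a left divisor of `a` (equivalently, `a` is a right multiple of `d`). -/
def IsLeftDivisor {M : Type u} [Monoid M] (d a : M) : Prop := ∃ e : M, a = d * e

/-- `d` is a right divisor of `a` (equivalently, `a` is a left multiple of `d`). -/
def IsRightDivisor {M : Type u} [Monoid M] (d a : M) : Prop := ∃ e : M, a = e * d

/-- `c` is a right lcm of `a` and `b`: a common right multiple of which every common right
multiple is a right multiple. -/
def IsRightLcm {M : Type u} [Monoid M] (a b c : M) : Prop :=
  IsLeftDivisor a c ∧ IsLeftDivisor b c ∧
    ∀ m : M, IsLeftDivisor a m → IsLeftDivisor b m → IsLeftDivisor c m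

/-- `c` is a left lcm of `a` and `b`: a common left multiple of which every common left
multiple is a left multiple. -/
def IsLeftLcm {M : Type u} [Monoid M] (a b c : M) : Prop :=
  IsRightDivisor a c ∧ IsRightDivisor b c ∧
    ∀ m : M, IsRightDivisor a m → IsRightDivisor b m → IsRightDivisor c m

/-- A Garside element of a monoid: its left divisors and its right divisors coincide, there are
finitely many of them, and they generate the monoid. -/
structure IsGarsideElement {M : Type u} [Monoid M] (δ : M) : Prop where
  left_iff_right : ∀ d : M, IsLeftDivisor d δ ↔ IsRightDivisor d δ
  finite_divisors : {d : M | IsLeftDivisor d δ}.Finite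
  closure_divisors : Submonoid.closure {d : M | IsLeftDivisor d δ} = ⊤

/-- A Garside monoid: a conical cancellative monoid in which any two elements have a left lcm
and a right lcm, and which has a Garside element. -/
structure IsGarsideMonoid (M : Type u) [Monoid M] : Prop where
  conical : ∀ x : M, IsUnit x → x = 1
  left_cancel : ∀ a b c : M, a * b = a * c → b = c
  right_cancel : ∀ a b c : M, b * a = c * a → b = c
  exists_rightLcm : ∀ a b : M, ∃ c : M, IsRightLcm a b c
  exists_leftLcm : ∀ a b : M, ∃ c : M, IsLeftLcm a b c
  exists_garsideElement : ∃ δ : M, IsGarsideElement δ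

/-- The enveloping group of a monoid `M`: the group generated by the elements of `M`, subject
to all the relations `b * c = d` that hold in `M`. -/
abbrev EnvelopingGroup (M : Type u) [Monoid M] : Type u :=
  PresentedGroup {r : FreeGroup M | ∃ b c d : M, b * c = d ∧
    r = FreeGroup.of b * FreeGroup.of c * (FreeGroup.of d)⁻¹}

/-- A Garside group: a group that is (isomorphic to) the enveloping group of a Garside monoid. -/
def IsGarsideGroup (G : Type u) [Group G] : Prop :=
  ∃ (M : Type u) (_ : Monoid M), IsGarsideMonoid M ∧ Nonempty (G ≃* EnvelopingGroup M)

/-- The group generated by the vertices of `T`, subject to the relation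
`a ^ lam a b = b ^ lam b a` for every edge `{a, b}` of `T`.
Only the values of `lam` at adjacent vertices matter. -/
abbrev TreeProduct {V : Type u} (T : SimpleGraph V) (lam : V → V → ℕ) : Type u :=
  PresentedGroup {r : FreeGroup V | ∃ a b : V, T.Adj a b ∧
    r = FreeGroup.of a ^ lam a b * (FreeGroup.of b ^ lam b a)⁻¹}

/-!
The Garside monoid is the submonoid `M` of `G(T)` generated by the vertices. As `M` lies in a group
it is cancellative, and as the defining relations of `G(T)` are equalities between elements of `M`,
the group `G(T)` is the enveloping group of `M`. Two features make `M` close to Garside: the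
vertices have positive weights compatible with the relations, which makes `M` conical and gives each
element finitely many divisors, and the vertices have a common power `δ`, which is then central and
serves as the Garside element. What remains is the existence of right lcms; left lcms follow by the
anti-automorphism of `G(T)` that fixes the vertices.

Right lcms are obtained by induction on the tree, `G(T)` being the amalgam of the group of a leaf
and of the group of the remaining tree over an infinite cyclic group `⟨z⟩`. Suppose more generally
that groups `G i` with positive cones `M i` having lcms are amalgamated along `⟨z⟩`, where
`z ∈ M i` for all `i` and every `g` in `G i` is of the form `z ^ k * s` for a unique `k` and a
unique `s ∈ M i` that is not left divisible by `z` in `M i`. These `s` form a transversal, so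
elements of the amalgam have a normal form `z ^ k * s₁ * ⋯ * sₙ`. The positive cone consists of
the elements with `0 ≤ k` (`CyclicAmalgamData.mem_cone_iff_height`): multiplying on the left by
an element of `M i` only involves `z ^ k` and possibly `s₁`. Writing an element as `g * w` with
`g ∈ G i` and `w` a normal word not starting in `G i`, it is positive exactly when `g ∈ M i`, hence
lcms in `M i` are lcms in the cone (`CyclicAmalgamData.isJoin_of`). If nontrivial `a ∈ M i` and
`b ∈ M j`, `i ≠ j`, both divide `y = z ^ k * w`, then `w` fails to start in `G i` or in `G j`, so
`a` or `b` divides `z ^ k` and thus `k ≥ 1`: also `z` divides `y`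
(`CyclicAmalgamData.of_inv_mul_mem_cone_of_ne`). Consequently, if `z ∨ a = z * x` and
`z ∨ b = z * x'`, then `a ∨ b = z * (x ∨ x')`, and `x`, `x'` have the common multiple `z⁻¹ * y`,
lighter than `y`. An induction on the weight of a common multiple (`hasJoins_of_generators`) then
yields all lcms.
-/

/-! ### Joins for the order defined by a submonoid of a group -/

/-- For a submonoid `M` of a group, read `x⁻¹ * y ∈ M` as `x ≤ y`: this relation is invariant under
left translation, and on `M` it is left divisibility. `IsJoin M x y c` says that `c` is a least
upper bound of `x` and `y` for it. -/
structure IsJoin {G : Type*} [Group G] (M : Submonoid G) (x y c : G) : Prop where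
  left : x⁻¹ * c ∈ M
  right : y⁻¹ * c ∈ M
  least : ∀ m : G, x⁻¹ * m ∈ M → y⁻¹ * m ∈ M → c⁻¹ * m ∈ M

/-- Any two elements of `M` have a right lcm in `M`. -/
def HasJoins {G : Type*} [Group G] (M : Submonoid G) : Prop :=
  ∀ x ∈ M, ∀ y ∈ M, ∃ c : G, IsJoin M x y c

section Joins

variable {G : Type*} [Group G] {M : Submonoid G}

theorem inv_mul_mem_trans {x y w : G} (hxy : x⁻¹ * y ∈ M) (hyw : y⁻¹ * w ∈ M) :
    x⁻¹ * w ∈ M := by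
  simpa [mul_assoc] using M.mul_mem hxy hyw

theorem IsJoin.mul_left {x y c : G} (h : IsJoin M x y c) (g : G) :
    IsJoin M (g * x) (g * y) (g * c) where
  left := by simpa [mul_assoc] using h.left
  right := by simpa [mul_assoc] using h.right
  least m hx hy := by
    have := h.least (g⁻¹ * m) (by simpa [mul_assoc] using hx) (by simpa [mul_assoc] using hy)
    simpa [mul_assoc] using this

/-- `x ∨ y = (s ∨ t) ∨ (x ∨ y)` computed in steps: if `s ≤ x` and `t ≤ y`, it suffices to join
`s ∨ t` to `x` and to `y`, and then to join the results. -/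
theorem IsJoin.of_refine {s t x y u a b c : G} (hsx : s⁻¹ * x ∈ M) (hty : t⁻¹ * y ∈ M)
    (hu : IsJoin M s t u) (ha : IsJoin M x u a) (hb : IsJoin M y u b) (hc : IsJoin M a b c) :
    IsJoin M x y c where
  left := inv_mul_mem_trans ha.left hc.left
  right := inv_mul_mem_trans hb.left hc.right
  least m hx hy := by
    have hum := hu.least m (inv_mul_mem_trans hsx hx) (inv_mul_mem_trans hty hy)
    exact hc.least m (ha.least m hx hum) (hb.least m hy hum)

/-- In a submonoid generated by elements of positive weight, joins of generators suffice. The join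
of two generators may be built from joins of elements with a lighter common multiple. -/
theorem hasJoins_of_generators {S : Set G} (hS : Submonoid.closure S = M)
    (W : G →* Multiplicative ℤ) (hW : ∀ s ∈ S, 0 < (W s).toAdd)
    (hcommon : ∀ x ∈ M, ∀ y ∈ M, ∃ m, x⁻¹ * m ∈ M ∧ y⁻¹ * m ∈ M)
    (hlocal : ∀ s ∈ S, ∀ t ∈ S, ∀ m, s⁻¹ * m ∈ M → t⁻¹ * m ∈ M →
      (∀ x ∈ M, ∀ y ∈ M, ∀ m', (W m').toAdd < (W m).toAdd → x⁻¹ * m' ∈ M → y⁻¹ * m' ∈ M →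
        ∃ c, IsJoin M x y c) →
      ∃ c, IsJoin M s t c) : HasJoins M := by
  have hnonneg : ∀ x ∈ M, 0 ≤ (W x).toAdd := by
    intro x hx
    rw [← hS] at hx
    induction hx using Submonoid.closure_induction with
    | mem x hx => exact (hW x hx).le
    | one => simp
    | mul x y _ _ hx hy => rw [map_mul, toAdd_mul]; omega
  have hfactor : ∀ x ∈ M, x = 1 ∨ ∃ s ∈ S, s⁻¹ * x ∈ M := by
    intro x hx
    rw [← hS] at hx
    induction hx using Submonoid.closure_induction_left with
    | one => exact Or.inl rfl
    | mul_left s hs y hy ih => exact Or.inr ⟨s, hs, by simpa [← hS] using hy⟩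
  have main : ∀ n : ℕ, ∀ x ∈ M, ∀ y ∈ M, ∀ m, (W m).toAdd < n → x⁻¹ * m ∈ M → y⁻¹ * m ∈ M →
      ∃ c, IsJoin M x y c := by
    intro n
    induction n with
    | zero =>
      intro x hx y hy m hm hxm _
      have := hnonneg m (by simpa using M.mul_mem hx hxm)
      simp only [Nat.cast_zero] at hm
      omega
    | succ n ih =>
      intro x hx y hy m hm hxm hym
      rcases hfactor x hx with rfl | ⟨s, hs, hsx⟩
      · exact ⟨y, by simpa using hy, by simp, fun m _ h => h⟩
      rcases hfactor y hy with rfl | ⟨t, ht, hty⟩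
      · exact ⟨x, by simp, by simpa using hx, fun m h _ => h⟩
      have hsM : s ∈ M := hS ▸ Submonoid.subset_closure hs
      have htM : t ∈ M := hS ▸ Submonoid.subset_closure ht
      have hsm := inv_mul_mem_trans hsx hxm
      have htm := inv_mul_mem_trans hty hym
      obtain ⟨u, hu⟩ := hlocal s hs t ht m hsm htm fun x hx y hy m' hm' =>
        ih x hx y hy m' (by push_cast at hm; omega)
      -- the two joins above a generator `r` are computed after cancelling `r`
      have step : ∀ r ∈ S, ∀ v w : G, r⁻¹ * v ∈ M → r⁻¹ * w ∈ M → v⁻¹ * m ∈ M → w⁻¹ * m ∈ M →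
          ∃ c, IsJoin M v w c := by
        intro r hr v w hv hw hvm hwm
        obtain ⟨c, hc⟩ := ih _ hv _ hw (r⁻¹ * m)
          (by
            have := hW r hr
            rw [map_mul, map_inv, toAdd_mul, toAdd_inv]
            push_cast at hm
            omega) (by simpa [mul_assoc] using hvm) (by simpa [mul_assoc] using hwm)
        exact ⟨r * c, by simpa using hc.mul_left r⟩
      have hum := hu.least m hsm htm
      obtain ⟨a, ha⟩ := step s hs x u hsx hu.left hxm hum
      obtain ⟨b, hb⟩ := step t ht y u hty hu.right hym hum
      obtain ⟨c, hc⟩ := step s hs a b (inv_mul_mem_trans hsx ha.left)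
        (inv_mul_mem_trans hu.left hb.right) (ha.least m hxm hum) (hb.least m hym hum)
      exact ⟨c, .of_refine hsx hty hu ha hb hc⟩
  intro x hx y hy
  obtain ⟨m, hxm, hym⟩ := hcommon x hx y hy
  obtain ⟨n, hn⟩ := exists_nat_gt (W m).toAdd
  exact main n x hx y hy m hn hxm hym

end Joins

/-! ### The positive cone of an amalgam over an infinite cyclic group -/

namespace Monoid.PushoutI

variable {ι : Type*} {G : ι → Type*} [∀ i, Group (G i)]

/-- Positivity data for a family of groups `G i` to be amalgamated along infinite cyclic subgroups
generated by `z i`: submonoids `M i ∋ z i`, such that every coset `⟨z i⟩ g` has a minimal element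
in `M i`. -/
structure CyclicAmalgamData (M : ∀ i, Submonoid (G i)) (z : ∀ i, G i) : Prop where
  mem : ∀ i, z i ∈ M i
  exists_pow_mul_mem : ∀ i, ∀ g : G i, ∃ n : ℕ, z i ^ n * g ∈ M i
  exists_pow_bound : ∀ i, ∀ g : G i, ∃ n : ℕ, ∀ k : ℤ, z i ^ k * g ∈ M i → -(n : ℤ) ≤ k

/-- The maps from the amalgamated infinite cyclic group to the factors. -/
abbrev cyclicHom (z : ∀ i, G i) (i : ι) : Multiplicative ℤ →* G i := zpowersHom (G i) (z i)

namespace CyclicAmalgamData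

variable {M : ∀ i, Submonoid (G i)} {z : ∀ i, G i}

theorem zpow_mul_mem (h : CyclicAmalgamData M z) {i : ι} {k l : ℤ} (hkl : k ≤ l) {g : G i}
    (hg : z i ^ k * g ∈ M i) : z i ^ l * g ∈ M i := by
  obtain ⟨n, rfl⟩ := Int.le.dest hkl
  rw [add_comm, zpow_add, mul_assoc, zpow_natCast]
  exact (M i).mul_mem ((M i).pow_mem (h.mem i) n) hg

theorem zpow_mem_iff (h : CyclicAmalgamData M z) {i : ι} {k : ℤ} : z i ^ k ∈ M i ↔ 0 ≤ k := by
  refine ⟨fun hk => ?_, fun hk => by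
    simpa using h.zpow_mul_mem (g := 1) hk (by simp)⟩
  by_contra! hneg
  obtain ⟨n, hn⟩ := h.exists_pow_bound i 1
  have := hn (k * (n + 1)) (by
    rw [mul_one, zpow_mul]
    exact_mod_cast (M i).pow_mem hk (n + 1))
  nlinarith

/-- The minimal elements of `M i` in the cosets of the amalgamated subgroup form a transversal. -/
def transversal (h : CyclicAmalgamData M z) : NormalWord.Transversal (cyclicHom z) where
  injective i := by
    rw [injective_iff_map_eq_one]
    intro a ha
    rw [zpowersHom_apply] at ha
    have h1 : 0 ≤ a.toAdd := h.zpow_mem_iff.1 (ha ▸ (M i).one_mem)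
    have h2 : 0 ≤ -a.toAdd := h.zpow_mem_iff.1 (by rw [zpow_neg, ha, inv_one]; exact (M i).one_mem)
    exact toAdd_eq_zero.1 (by omega)
  set i := {g | g ∈ M i ∧ (z i)⁻¹ * g ∉ M i}
  one_mem i := ⟨(M i).one_mem, fun hmem => by
    have : (0 : ℤ) ≤ -1 := h.zpow_mem_iff.1 (by simpa using hmem)
    omega⟩
  compl i := by
    rw [Subgroup.isComplement_iff_existsUnique]
    intro g
    obtain ⟨n, hn⟩ := h.exists_pow_mul_mem i g
    obtain ⟨b, hb⟩ := h.exists_pow_bound i g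
    obtain ⟨k, hk, hmin⟩ := Int.exists_least_of_bdd (P := fun k : ℤ => z i ^ k * g ∈ M i)
      ⟨-b, hb⟩ ⟨n, by simpa using hn⟩
    refine ⟨⟨⟨z i ^ (-k), Multiplicative.ofAdd (-k), by simp⟩, ⟨z i ^ k * g, hk, fun hlt => ?_⟩⟩,
      by simp, ?_⟩
    · have := hmin (k - 1) (by
        rw [show k - 1 = -1 + k by ring, zpow_add, mul_assoc]
        simpa using hlt)
      omega
    · rintro ⟨⟨x, a, hx⟩, ⟨s, hs1, hs2⟩⟩ hxs
      rw [zpowersHom_apply] at hx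
      simp only at hxs
      obtain rfl : s = z i ^ (-a.toAdd) * g := by rw [← hxs, ← hx]; simp
      have hle := hmin _ hs1
      have : k = -a.toAdd := by
        by_contra hne
        refine hs2 ?_
        have := h.zpow_mul_mem (show k ≤ -1 + -a.toAdd by omega) hk
        rw [zpow_add, mul_assoc] at this
        simpa using this
      subst this
      simp [← hx]

/-- The positive cone of the amalgam: the submonoid generated by the `M i`. -/
def cone (_ : CyclicAmalgamData M z) : Submonoid (PushoutI (cyclicHom z)) :=
  ⨆ i, (M i).map (of i)

theorem of_mem_cone (h : CyclicAmalgamData M z) {i : ι} {g : G i} (hg : g ∈ M i) :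
    (of i g : PushoutI (cyclicHom z)) ∈ h.cone :=
  Submonoid.mem_iSup_of_mem i (Submonoid.mem_map_of_mem _ hg)

variable [DecidableEq ι] [∀ i, DecidableEq (G i)]

/-- The exponent `k` in the normal form `z ^ k * w` of an element of the amalgam. -/
noncomputable def height (h : CyclicAmalgamData M z) (y : PushoutI (cyclicHom z)) : ℤ :=
  (y • (NormalWord.empty (d := h.transversal))).head.toAdd

/-- The factor `g` of the decomposition `y = g * w`, where `g` belongs to `G i` and `w` is a normal
word that does not start with a letter of `G i`. -/
noncomputable def factor (h : CyclicAmalgamData M z) (i : ι) (y : PushoutI (cyclicHom z)) : G i :=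
  (NormalWord.equivPair i (y • (NormalWord.empty (d := h.transversal)))).head

theorem factor_of_mul (h : CyclicAmalgamData M z) (i : ι) (g : G i)
    (y : PushoutI (cyclicHom z)) : h.factor i (of i g * y) = g * h.factor i y := by
  rw [factor, mul_smul, NormalWord.summand_smul_def, Equiv.apply_symm_apply]
  rfl

theorem factor_mem_iff (h : CyclicAmalgamData M z) (i : ι) (y : PushoutI (cyclicHom z)) :
    h.factor i y ∈ M i ↔ 0 ≤ h.height y := by
  set w := y • (NormalWord.empty (d := h.transversal)) with hw
  set p := NormalWord.equivPair i w with hp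
  have hwp : w = NormalWord.rcons i p := ((NormalWord.equivPair i).symm_apply_apply w).symm
  set n := (h.transversal.compl i).equiv p.head with hn
  have hhead : cyclicHom z i w.head = n.1 := by
    rw [hwp]
    exact MonoidHom.apply_ofInjective_symm (h.transversal.injective i) n.1
  have hfac : p.head = z i ^ w.head.toAdd * n.2 := by
    rw [← zpowersHom_apply]
    change _ = cyclicHom z i w.head * _
    rw [hhead]
    exact ((h.transversal.compl i).equiv_fst_mul_equiv_snd p.head).symm
  obtain ⟨hs1, hs2⟩ : (n.2 : G i) ∈ M i ∧ (z i)⁻¹ * (n.2 : G i) ∉ M i := n.2.2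
  change p.head ∈ M i ↔ 0 ≤ w.head.toAdd
  rw [hfac]
  constructor
  · intro hmem
    by_contra! hlt
    refine hs2 ?_
    simpa using h.zpow_mul_mem (show w.head.toAdd ≤ -1 by omega) hmem
  · intro hle
    exact (M i).mul_mem (h.zpow_mem_iff.2 hle) hs1

/-- A normal word starts with a letter of at most one factor. -/
theorem factor_eq_zpow_height (h : CyclicAmalgamData M z) {i j : ι} (hij : i ≠ j)
    (y : PushoutI (cyclicHom z)) :
    h.factor i y = z i ^ h.height y ∨ h.factor j y = z j ^ h.height y := by
  set w := y • (NormalWord.empty (d := h.transversal)) with hw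
  have key : ∀ k, w.fstIdx ≠ some k → h.factor k y = z k ^ h.height y := by
    intro k hk
    change (CoprodI.Word.equivPair k (CoprodI.of (cyclicHom z k w.head) • w.toWord)).head = _
    rw [CoprodI.Word.equivPair_smul_same, CoprodI.Word.equivPair_eq_of_fstIdx_ne hk]
    simp [height, ← hw]
  by_cases hi : w.fstIdx = some i
  · exact Or.inr (key j (by rw [hi]; simpa using hij))
  · exact Or.inl (key i hi)

theorem mem_cone_iff_height [Nonempty ι] (h : CyclicAmalgamData M z)
    (y : PushoutI (cyclicHom z)) : y ∈ h.cone ↔ 0 ≤ h.height y := by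
  constructor
  · intro hy
    have hcone : h.cone =
        Submonoid.closure
          (⋃ i, (((M i).map (of i) : Submonoid (PushoutI (cyclicHom z))) : Set _)) := by
      simp only [Submonoid.closure_iUnion, Submonoid.closure_eq, cone]
    rw [hcone] at hy
    induction hy using Submonoid.closure_induction_left with
    | one => simp [height, NormalWord.empty]
    | mul_left x hx y _ ih =>
      obtain ⟨i, g, hg, rfl⟩ := Set.mem_iUnion.1 hx
      rw [← h.factor_mem_iff i, factor_of_mul]
      exact (M i).mul_mem hg ((h.factor_mem_iff i y).2 ih)
  · intro hy
    set w := y • (NormalWord.empty (d := h.transversal)) with hw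
    have hyw : y = w.prod := by rw [hw, NormalWord.prod_smul, NormalWord.prod_empty, mul_one]
    rw [hyw, NormalWord.prod]
    refine mul_mem ?_ ?_
    · obtain ⟨i⟩ := ‹Nonempty ι›
      rw [← of_apply_eq_base _ i]
      exact h.of_mem_cone (by
        rw [zpowersHom_apply]
        exact h.zpow_mem_iff.2 hy)
    · rw [CoprodI.Word.prod, map_list_prod]
      refine Submonoid.list_prod_mem _ fun x hx => ?_
      simp only [List.map_map, List.mem_map, Function.comp_apply, ofCoprodI_of] at hx
      obtain ⟨⟨i, g⟩, hg, rfl⟩ := hx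
      exact h.of_mem_cone (w.normalized i g hg).1

theorem mem_cone_iff (h : CyclicAmalgamData M z) (i : ι) (y : PushoutI (cyclicHom z)) :
    y ∈ h.cone ↔ h.factor i y ∈ M i := by
  have : Nonempty ι := ⟨i⟩
  rw [h.factor_mem_iff, h.mem_cone_iff_height]

theorem of_inv_mul_mem_cone_iff (h : CyclicAmalgamData M z) {i : ι} (g : G i)
    (y : PushoutI (cyclicHom z)) : (of i g)⁻¹ * y ∈ h.cone ↔ g⁻¹ * h.factor i y ∈ M i := by
  rw [h.mem_cone_iff i, ← map_inv, factor_of_mul]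

/-- Joins in a factor remain joins in the amalgam. -/
theorem isJoin_of (h : CyclicAmalgamData M z) {i : ι} {a b c : G i} (hc : IsJoin (M i) a b c) :
    IsJoin h.cone (of i a) (of i b) (of i c : PushoutI (cyclicHom z)) where
  left := by
    rw [← map_inv, ← map_mul]
    exact h.of_mem_cone hc.left
  right := by
    rw [← map_inv, ← map_mul]
    exact h.of_mem_cone hc.right
  least m ha hb := by
    rw [of_inv_mul_mem_cone_iff] at *
    exact hc.least _ ha hb

/-- A common multiple of nontrivial elements of two distinct factors is a multiple of the
generator of the amalgamated subgroup. -/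
theorem of_inv_mul_mem_cone_of_ne (h : CyclicAmalgamData M z)
    (hM : ∀ i, ∀ g ∈ M i, g⁻¹ ∈ M i → g = 1) {i j : ι} (hij : i ≠ j) {a : G i} {b : G j}
    (ha : a ∈ M i) (hb : b ∈ M j) (ha1 : a ≠ 1) (hb1 : b ≠ 1) {y : PushoutI (cyclicHom z)}
    (hay : (of i a)⁻¹ * y ∈ h.cone) (hby : (of j b)⁻¹ * y ∈ h.cone) (k : ι) :
    (of k (z k))⁻¹ * y ∈ h.cone := by
  have key : ∀ l, ∀ g ∈ M l, g ≠ 1 → (of l g)⁻¹ * y ∈ h.cone →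
      h.factor l y = z l ^ h.height y → (of l (z l))⁻¹ * y ∈ h.cone := by
    intro l g hg hg1 hgy hl
    have hy : 0 ≤ h.height y := by
      rw [← h.factor_mem_iff l]
      rw [of_inv_mul_mem_cone_iff] at hgy
      simpa using (M l).mul_mem hg hgy
    rw [of_inv_mul_mem_cone_iff, hl] at hgy ⊢
    have hne : h.height y ≠ 0 := fun h0 => hg1 (hM l g hg (by simpa [h0] using hgy))
    rw [← zpow_neg_one, ← zpow_add]
    exact h.zpow_mem_iff.2 (by omega)
  have hz : ∀ l, (of l (z l) : PushoutI (cyclicHom z)) = of k (z k) := by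
    intro l
    have h1 := of_apply_eq_base (cyclicHom z) l (Multiplicative.ofAdd 1)
    have h2 := of_apply_eq_base (cyclicHom z) k (Multiplicative.ofAdd 1)
    rw [← h2] at h1
    simpa using h1
  rcases h.factor_eq_zpow_height hij y with hl | hl
  · rw [← hz i]; exact key i a ha ha1 hay hl
  · rw [← hz j]; exact key j b hb hb1 hby hl

/-- An amalgam of cones with joins has joins, provided that it carries a positive weight and has
common multiples. -/
theorem hasJoins_cone (h : CyclicAmalgamData M z) (hM : ∀ i, HasJoins (M i))
    (W : PushoutI (cyclicHom z) →* Multiplicative ℤ)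
    (hW : ∀ i, ∀ g ∈ M i, g ≠ 1 → 0 < (W (of i g)).toAdd)
    (hcommon : ∀ x ∈ h.cone, ∀ y ∈ h.cone, ∃ m, x⁻¹ * m ∈ h.cone ∧ y⁻¹ * m ∈ h.cone) :
    HasJoins h.cone := by
  have hM1 : ∀ i, ∀ g ∈ M i, g⁻¹ ∈ M i → g = 1 := by
    intro i g hg hg'
    by_contra hne
    have h1 := hW i g hg hne
    have h2 := hW i g⁻¹ hg' (by simpa using hne)
    rw [map_inv, map_inv, toAdd_inv] at h2
    omega
  have hz1 : ∀ i, z i ≠ 1 := by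
    intro i hi
    have : (0 : ℤ) ≤ -1 := h.zpow_mem_iff.1 (by rw [hi, one_zpow]; exact (M i).one_mem)
    omega
  refine hasJoins_of_generators (S := ⋃ i, of i '' {g | g ∈ M i ∧ g ≠ 1}) ?_ W ?_ hcommon ?_
  · rw [Submonoid.closure_iUnion, cone]
    refine iSup_congr fun i => ?_
    rw [← MonoidHom.map_mclosure]
    congr 1
    refine le_antisymm (Submonoid.closure_le.2 fun g hg => hg.1) fun g hg => ?_
    by_cases hg1 : g = 1
    · rw [hg1]; exact one_mem _
    · exact Submonoid.subset_closure ⟨hg, hg1⟩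
  · intro s hs
    obtain ⟨i, g, ⟨hg, hg1⟩, rfl⟩ := Set.mem_iUnion.1 hs
    exact hW i g hg hg1
  · intro s hs t ht m hsm htm ih
    obtain ⟨i, a, ⟨ha, ha1⟩, rfl⟩ := Set.mem_iUnion.1 hs
    obtain ⟨j, b, ⟨hb, hb1⟩, rfl⟩ := Set.mem_iUnion.1 ht
    by_cases hij : i = j
    · subst hij
      obtain ⟨c, hc⟩ := hM i a ha b hb
      exact ⟨_, h.isJoin_of hc⟩
    -- Every common multiple of `a` and `b` is a multiple of `z`, hence of `z ∨ a` and of `z ∨ b`.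
    obtain ⟨u, hu⟩ := hM i a ha (z i) (h.mem i)
    obtain ⟨v, hv⟩ := hM j b hb (z j) (h.mem j)
    have hu := h.isJoin_of hu
    have hv := h.isJoin_of hv
    have hz : (of j (z j) : PushoutI (cyclicHom z)) = of i (z i) := by
      have h1 := of_apply_eq_base (cyclicHom z) i (Multiplicative.ofAdd 1)
      have h2 := of_apply_eq_base (cyclicHom z) j (Multiplicative.ofAdd 1)
      rw [← h2] at h1
      simpa using h1.symm
    rw [hz] at hv
    have hzm := fun m h1 h2 => h.of_inv_mul_mem_cone_of_ne hM1 hij ha hb ha1 hb1 (y := m) h1 h2 i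
    obtain ⟨c, hc⟩ := ih _ hu.right _ hv.right ((of i (z i))⁻¹ * m)
      (by
        have := hW i (z i) (h.mem i) (hz1 i)
        rw [map_mul, map_inv, toAdd_mul, toAdd_inv]
        omega)
      (by simpa [mul_assoc] using hu.least m hsm (hzm m hsm htm))
      (by simpa [mul_assoc] using hv.least m htm (hzm m hsm htm))
    have hc := hc.mul_left (of i (z i))
    rw [mul_inv_cancel_left, mul_inv_cancel_left] at hc
    refine ⟨_, inv_mul_mem_trans hu.left hc.left, inv_mul_mem_trans hv.left hc.right, ?_⟩
    intro m' h1 h2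
    exact hc.least m' (hu.least m' h1 (hzm m' h1 h2)) (hv.least m' h2 (hzm m' h1 h2))

end CyclicAmalgamData

end Monoid.PushoutI

/-! ### Generating families of Garside type -/

/-- A generating family of a group whose members have a common power, which is then central,
and for which the submonoid generated by the family carries a positive weight and has right lcms. -/
structure GarsideFamily {V G : Type*} [Group G] (e : V → G) : Prop where
  closure_eq_top : Subgroup.closure (Set.range e) = ⊤
  exists_weight : ∃ W : G →* Multiplicative ℤ, ∀ v, 0 < (W (e v)).toAdd
  exists_common_pow : ∃ δ : G, ∀ v, ∃ n : ℕ, 0 < n ∧ e v ^ n = δ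
  hasJoins : HasJoins (Submonoid.closure (Set.range e))

section Families

variable {V G : Type*} [Group G] {e : V → G}

theorem subset_closure_range (v : V) : e v ∈ Submonoid.closure (Set.range e) :=
  Submonoid.subset_closure ⟨v, rfl⟩

theorem commute_of_common_pow (he : Subgroup.closure (Set.range e) = ⊤) {δ : G}
    (hδ : ∀ v, ∃ n : ℕ, 0 < n ∧ e v ^ n = δ) (g : G) : Commute δ g := by
  have hg : g ∈ Subgroup.closure (Set.range e) := he ▸ Subgroup.mem_top g
  induction hg using Subgroup.closure_induction with
  | mem x hx =>
    obtain ⟨v, rfl⟩ := hx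
    obtain ⟨n, -, rfl⟩ := hδ v
    exact (Commute.refl (e v)).pow_left n
  | one => exact Commute.one_right _
  | mul x y _ _ hx hy => exact hx.mul_right hy
  | inv x _ hx => exact hx.inv_right

/-- Every element of the group becomes positive after multiplication by a power of the common
power of the generators. -/
theorem exists_pow_mul_mem_of_common_pow (he : Subgroup.closure (Set.range e) = ⊤) {δ : G}
    (hδ : ∀ v, ∃ n : ℕ, 0 < n ∧ e v ^ n = δ) (g : G) :
    ∃ n : ℕ, δ ^ n * g ∈ Submonoid.closure (Set.range e) := by
  have hg : g ∈ Subgroup.closure (Set.range e) := he ▸ Subgroup.mem_top g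
  induction hg using Subgroup.closure_induction_left with
  | one => exact ⟨0, by simp⟩
  | mul_left x hx y hy ih =>
    obtain ⟨n, hn⟩ := ih
    refine ⟨n, ?_⟩
    rw [← mul_assoc, ((commute_of_common_pow he hδ x).pow_left n).eq, mul_assoc]
    exact mul_mem (Submonoid.subset_closure hx) hn
  | inv_mul_cancel x hx y hy ih =>
    obtain ⟨n, hn⟩ := ih
    refine ⟨n + 1, ?_⟩
    rw [← mul_assoc, pow_succ, mul_assoc (δ ^ n),
      ((commute_of_common_pow he hδ (δ * x⁻¹)).pow_left n).eq, mul_assoc]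
    refine mul_mem ?_ hn
    obtain ⟨v, rfl⟩ := hx
    obtain ⟨m, hm, rfl⟩ := hδ v
    obtain ⟨k, rfl⟩ := Nat.exists_eq_add_one.2 hm
    rw [pow_succ, mul_inv_cancel_right]
    exact pow_mem (subset_closure_range v) k

theorem exists_common_multiple_of_common_pow (he : Subgroup.closure (Set.range e) = ⊤) {δ : G}
    (hδ : ∀ v, ∃ n : ℕ, 0 < n ∧ e v ^ n = δ) (hδM : δ ∈ Submonoid.closure (Set.range e))
    (x y : G) : ∃ m, x⁻¹ * m ∈ Submonoid.closure (Set.range e) ∧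
      y⁻¹ * m ∈ Submonoid.closure (Set.range e) := by
  obtain ⟨k, hk⟩ := exists_pow_mul_mem_of_common_pow he hδ x⁻¹
  obtain ⟨l, hl⟩ := exists_pow_mul_mem_of_common_pow he hδ y⁻¹
  refine ⟨δ ^ (k + l), ?_, ?_⟩
  · rw [← ((commute_of_common_pow he hδ x⁻¹).pow_left _).eq, add_comm, pow_add, mul_assoc]
    exact mul_mem (pow_mem hδM l) hk
  · rw [← ((commute_of_common_pow he hδ y⁻¹).pow_left _).eq, pow_add, mul_assoc]
    exact mul_mem (pow_mem hδM k) hl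

theorem weight_pos_of_mem_closure {W : G →* Multiplicative ℤ} (hW : ∀ v, 0 < (W (e v)).toAdd)
    {x : G} (hx : x ∈ Submonoid.closure (Set.range e)) (hx1 : x ≠ 1) : 0 < (W x).toAdd := by
  have : x = 1 ∨ 0 < (W x).toAdd := by
    induction hx using Submonoid.closure_induction_left with
    | one => exact Or.inl rfl
    | mul_left s hs y _ ih =>
      obtain ⟨v, rfl⟩ := hs
      right
      rw [map_mul, toAdd_mul]
      have := hW v
      by_cases hy : y = 1
      · simpa [hy] using this
      · have := ih hy
        rcases this with h | h
        · exact absurd h hy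
        · omega
  exact this.resolve_left hx1

theorem weight_nonneg_of_mem_closure {W : G →* Multiplicative ℤ} (hW : ∀ v, 0 < (W (e v)).toAdd)
    {x : G} (hx : x ∈ Submonoid.closure (Set.range e)) : 0 ≤ (W x).toAdd := by
  by_cases hx1 : x = 1
  · simp [hx1]
  · exact (weight_pos_of_mem_closure hW hx hx1).le

/-- A single generator of infinite order. -/
theorem GarsideFamily.of_subsingleton [Subsingleton V] [Nonempty V]
    (he : Subgroup.closure (Set.range e) = ⊤)
    (hW : ∃ W : G →* Multiplicative ℤ, ∀ v, 0 < (W (e v)).toAdd) : GarsideFamily e where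
  closure_eq_top := he
  exists_weight := hW
  exists_common_pow := by
    obtain ⟨v⟩ := ‹Nonempty V›
    exact ⟨e v, fun w => ⟨1, one_pos, by rw [Subsingleton.elim w v, pow_one]⟩⟩
  hasJoins := by
    obtain ⟨v⟩ := ‹Nonempty V›
    have hmem : ∀ x, x ∈ Submonoid.closure (Set.range e) ↔ ∃ n : ℕ, e v ^ n = x := by
      intro x
      have : Set.range e = {e v} := by
        ext y
        constructor
        · rintro ⟨w, rfl⟩
          rw [Subsingleton.elim w v]
          rfl
        · rintro rfl
          exact ⟨v, rfl⟩
      rw [this, Submonoid.mem_closure_singleton]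
    intro x hx y hy
    obtain ⟨i, rfl⟩ := (hmem x).1 hx
    obtain ⟨j, rfl⟩ := (hmem y).1 hy
    have hle : ∀ {k l : ℕ}, k ≤ l → (e v ^ k)⁻¹ * e v ^ l ∈ Submonoid.closure (Set.range e) := by
      intro k l hkl
      obtain ⟨n, rfl⟩ := Nat.exists_eq_add_of_le hkl
      rw [pow_add, inv_mul_cancel_left]
      exact pow_mem (subset_closure_range v) n
    rcases le_total i j with h | h
    · exact ⟨_, hle h, hle le_rfl, fun m _ hm => hm⟩
    · exact ⟨_, hle le_rfl, hle h, fun m hm _ => hm⟩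

/-- The notion depends only on the set of generators, up to an isomorphism of groups. -/
theorem GarsideFamily.of_mulEquiv {V' G' : Type*} [Group G'] {e' : V' → G'}
    (h : GarsideFamily e) (f : G ≃* G') (σ : V' → V) (hσ : Function.Surjective σ)
    (hf : ∀ v, f (e (σ v)) = e' v) : GarsideFamily e' := by
  have hrange : Set.range e' = f '' Set.range e := by
    rw [← Set.range_comp, ← hσ.range_comp (f ∘ e)]
    exact congrArg Set.range (funext fun v => (hf v).symm)
  have hmem : ∀ x, x ∈ Submonoid.closure (Set.range e') ↔
      f.symm x ∈ Submonoid.closure (Set.range e) := by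
    intro x
    rw [hrange, ← MonoidHom.coe_coe f, ← MonoidHom.map_mclosure, Submonoid.mem_map]
    constructor
    · rintro ⟨y, hy, rfl⟩
      simpa using hy
    · exact fun hx => ⟨_, hx, by simp⟩
  refine ⟨?_, ?_, ?_, ?_⟩
  · rw [hrange, ← MonoidHom.coe_coe f, ← MonoidHom.map_closure, h.closure_eq_top]
    exact Subgroup.map_top_of_surjective _ f.surjective
  · obtain ⟨W, hW⟩ := h.exists_weight
    exact ⟨W.comp f.symm, fun v => by simpa [← hf] using hW (σ v)⟩
  · obtain ⟨δ, hδ⟩ := h.exists_common_pow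
    refine ⟨f δ, fun v => ?_⟩
    obtain ⟨n, hn, hδn⟩ := hδ (σ v)
    exact ⟨n, hn, by rw [← hf, ← map_pow, hδn]⟩
  · intro x hx y hy
    obtain ⟨c, hc⟩ := h.hasJoins _ ((hmem x).1 hx) _ ((hmem y).1 hy)
    refine ⟨f c, ?_, ?_, fun m hm hm' => ?_⟩
    · simpa [hmem] using hc.left
    · simpa [hmem] using hc.right
    · rw [hmem] at *
      simpa using hc.least (f.symm m) (by simpa using hm) (by simpa using hm')

end Families

section Amalgam

open Monoid Monoid.PushoutI

variable {ι : Type*} {V G : ι → Type*} [∀ i, Group (G i)]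
  {e : ∀ i, V i → G i}

theorem GarsideFamily.cyclicAmalgamData (h : ∀ i, GarsideFamily (e i)) (v : ∀ i, V i)
    {q : ι → ℕ} (hq : ∀ i, 0 < q i) :
    CyclicAmalgamData (fun i => Submonoid.closure (Set.range (e i)))
      (fun i => e i (v i) ^ q i) where
  mem i := pow_mem (subset_closure_range _) _
  exists_pow_mul_mem i g := by
    obtain ⟨δ, hδ⟩ := (h i).exists_common_pow
    obtain ⟨n, hn⟩ := exists_pow_mul_mem_of_common_pow (h i).closure_eq_top hδ g
    obtain ⟨k, hk, rfl⟩ := hδ (v i)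
    obtain ⟨r, hr⟩ := Nat.exists_eq_add_one.2 (hq i)
    refine ⟨k * n, ?_⟩
    have : (e i (v i) ^ q i) ^ (k * n) * g =
        e i (v i) ^ (r * (k * n)) * ((e i (v i) ^ k) ^ n * g) := by
      rw [← mul_assoc, ← pow_mul, ← pow_mul, ← pow_add, hr]
      congr 2
      ring
    rw [this]
    exact mul_mem (pow_mem (subset_closure_range _) _) hn
  exists_pow_bound i g := by
    obtain ⟨W, hW⟩ := (h i).exists_weight
    refine ⟨(W g).toAdd.natAbs, fun k hk => ?_⟩
    have h1 := weight_nonneg_of_mem_closure hW hk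
    rw [map_mul, map_zpow, map_pow, toAdd_mul, toAdd_zpow, toAdd_pow, smul_eq_mul, nsmul_eq_mul]
      at h1
    have h2 : 0 < (q i : ℤ) * (W (e i (v i))).toAdd := mul_pos (by exact_mod_cast hq i) (hW _)
    have h3 := neg_abs_le (W g).toAdd
    have h4 := le_abs_self (W g).toAdd
    rw [Int.natCast_natAbs]
    by_contra! hlt
    nlinarith [abs_nonneg (W g).toAdd]

/-- Amalgamating groups with generating families of Garside type along powers of one generator of
each yields again such a group. -/
theorem GarsideFamily.amalgam [Fintype ι] [Nonempty ι] (h : ∀ i, GarsideFamily (e i))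
    (v : ∀ i, V i) {q : ι → ℕ} (hq : ∀ i, 0 < q i) :
    GarsideFamily (fun p : Σ i, V i =>
      (of p.1 (e p.1 p.2) : PushoutI (cyclicHom fun i => e i (v i) ^ q i))) := by
  classical
  set z : ∀ i, G i := fun i => e i (v i) ^ q i
  have hz : ∀ i, z i = e i (v i) ^ q i := fun _ => rfl
  set E : (Σ i, V i) → PushoutI (cyclicHom z) := fun p => of p.1 (e p.1 p.2) with hE
  have hdata := GarsideFamily.cyclicAmalgamData h v hq
  have hbase : ∀ i, (of i (z i) : PushoutI (cyclicHom z)) = base _ (Multiplicative.ofAdd 1) := by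
    intro i
    rw [← of_apply_eq_base (cyclicHom z) i]
    simp
  have htop : Subgroup.closure (Set.range E) = ⊤ := by
    have hof : ∀ i (g : G i),
        (of i g : PushoutI (cyclicHom z)) ∈ Subgroup.closure (Set.range E) := by
      intro i g
      have hg : g ∈ Subgroup.closure (Set.range (e i)) :=
        (h i).closure_eq_top ▸ Subgroup.mem_top g
      refine (Subgroup.closure_le (K := (Subgroup.closure (Set.range E)).comap (of i))).2 ?_ hg
      rintro _ ⟨w, rfl⟩
      exact Subgroup.subset_closure ⟨⟨i, w⟩, rfl⟩
    refine eq_top_iff.2 fun x _ => ?_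
    induction x using PushoutI.induction_on with
    | of i g => exact hof i g
    | base g =>
      obtain ⟨i⟩ := ‹Nonempty ι›
      rw [← of_apply_eq_base _ i]
      exact hof i _
    | mul x y hx hy => exact mul_mem (hx trivial) (hy trivial)
  have hweight : ∃ W : PushoutI (cyclicHom z) →* Multiplicative ℤ,
      ∀ p, 0 < (W (E p)).toAdd := by
    choose W hW using fun i => (h i).exists_weight
    have ht : ∀ i, 0 < (W i (z i)).toAdd := fun i => by
      rw [hz, map_pow, toAdd_pow, nsmul_eq_mul]
      exact mul_pos (by exact_mod_cast hq i) (hW i _)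
    -- the weights are rescaled so as to agree on the amalgamated generator
    refine ⟨lift (fun i => (zpowGroupHom (∏ j ∈ Finset.univ.erase i, (W j (z j)).toAdd)).comp (W i))
      (zpowersHom _ (Multiplicative.ofAdd (∏ j, (W j (z j)).toAdd))) ?_, ?_⟩
    · intro i
      refine MonoidHom.ext_mint ?_
      apply Multiplicative.toAdd.injective
      simp [Finset.prod_erase_mul _ _ (Finset.mem_univ i)]
    · rintro ⟨i, w⟩
      simp only [hE, lift_of, MonoidHom.comp_apply, zpowGroupHom_apply, toAdd_zpow, smul_eq_mul]
      exact mul_pos (Finset.prod_pos fun j _ => ht j) (hW i w)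
  have hpow : ∃ δ ∈ Submonoid.closure (Set.range E), ∀ p, ∃ n : ℕ, 0 < n ∧ E p ^ n = δ := by
    choose δ hδ using fun i => (h i).exists_common_pow
    choose n hn hδn using hδ
    refine ⟨base _ (Multiplicative.ofAdd 1) ^ ∏ i, n i (v i), ?_, ?_⟩
    · obtain ⟨i⟩ := ‹Nonempty ι›
      rw [← hbase i, hz, map_pow]
      exact pow_mem (pow_mem (subset_closure_range (e := E) ⟨i, v i⟩) _) _
    · rintro ⟨i, w⟩
      refine ⟨n i w * q i * ∏ j ∈ Finset.univ.erase i, n j (v j),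
        Nat.mul_pos (Nat.mul_pos (hn i w) (hq i)) (Finset.prod_pos fun j _ => hn j _), ?_⟩
      rw [← Finset.mul_prod_erase _ _ (Finset.mem_univ i), pow_mul, pow_mul, pow_mul, ← hbase i]
      congr 1
      simp only [hE, hz, ← map_pow]
      rw [hδn, ← hδn i (v i), ← pow_mul, ← pow_mul, mul_comm]
  obtain ⟨W, hW⟩ := hweight
  obtain ⟨δ, hδM, hδ⟩ := hpow
  have hcone : hdata.cone = Submonoid.closure (Set.range E) := by
    rw [CyclicAmalgamData.cone, Set.range_sigma_eq_iUnion_range, Submonoid.closure_iUnion]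
    refine iSup_congr fun i => ?_
    rw [MonoidHom.map_mclosure, ← Set.range_comp]
    rfl
  refine ⟨htop, ⟨W, hW⟩, ⟨δ, hδ⟩, ?_⟩
  rw [← hcone]
  refine hdata.hasJoins_cone (fun i => (h i).hasJoins) W ?_ ?_
  · intro i g hg hg1
    exact weight_pos_of_mem_closure (W := W.comp (of i)) (fun w => hW ⟨i, w⟩) hg hg1
  · rw [hcone]
    exact fun x _ y _ => exists_common_multiple_of_common_pow htop hδ hδM x y

end Amalgam

/-! ### Tree products -/

section TreeProducts

open Monoid Monoid.PushoutI

variable {V : Type u} {T : SimpleGraph V} {lam : V → V → ℕ}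

namespace TreeProduct

theorem of_pow_eq {a b : V} (hab : T.Adj a b) :
    (PresentedGroup.of a : TreeProduct T lam) ^ lam a b = PresentedGroup.of b ^ lam b a :=
  PresentedGroup.mk_eq_mk_of_mul_inv_mem ⟨a, b, hab, rfl⟩

/-- The universal property of a tree product. -/
def lift {K : Type*} [Group K] (f : V → K)
    (hf : ∀ a b, T.Adj a b → f a ^ lam a b = f b ^ lam b a) : TreeProduct T lam →* K :=
  PresentedGroup.toGroup (f := f) (by
    rintro _ ⟨a, b, hab, rfl⟩
    simp [hf a b hab])

@[simp]
theorem lift_of {K : Type*} [Group K] (f : V → K)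
    (hf : ∀ a b, T.Adj a b → f a ^ lam a b = f b ^ lam b a) (a : V) :
    lift f hf (PresentedGroup.of a) = f a :=
  PresentedGroup.toGroup.of _

/-- The tree product of the subgraph induced on a set of vertices. -/
abbrev Induced (T : SimpleGraph V) (lam : V → V → ℕ) (s : Set V) : Type u :=
  TreeProduct (T.induce s) (fun x y => lam x y)

/-- If `c` splits the vertices into classes, and if the edges between distinct classes join the
chosen representatives `v i` of all classes, then the tree product is the amalgam of the
tree products of the classes. -/
theorem nonempty_mulEquiv_pushoutI {ι : Type*} (c : V → ι) (v : ∀ i, {x | c x = i})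
    (q : ι → ℕ) (hv : ∀ i j, i ≠ j → T.Adj (v i : V) (v j) ∧ lam (v i) (v j) = q i)
    (hc : ∀ x y, T.Adj x y → c x ≠ c y → x = v (c x) ∧ y = v (c y)) [Nonempty ι] :
    ∃ f : PushoutI (cyclicHom fun i =>
        (PresentedGroup.of (v i) : Induced T lam {x | c x = i}) ^ q i) ≃* TreeProduct T lam,
      ∀ i (x : {x | c x = i}), f (of i (PresentedGroup.of x)) = PresentedGroup.of (x : V) := by
  set z : ∀ i, Induced T lam {x | c x = i} := fun i => PresentedGroup.of (v i) ^ q i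
  have hbase : ∀ i, (of i (PresentedGroup.of (v i)) : PushoutI (cyclicHom z)) ^ q i =
      base _ (Multiplicative.ofAdd 1) := by
    intro i
    rw [← of_apply_eq_base (cyclicHom z) i, ← map_pow]
    simp [z]
  let incl : ∀ i, Induced T lam {x | c x = i} →* TreeProduct T lam := fun i =>
    TreeProduct.lift (fun x => PresentedGroup.of (x : V)) fun a b hab => of_pow_eq hab
  have hincl : ∀ i x, incl i (PresentedGroup.of x) = PresentedGroup.of (x : V) :=
    fun i x => TreeProduct.lift_of _ _ _
  obtain ⟨i₀⟩ := ‹Nonempty ι›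
  have hz : ∀ i, incl i (z i) = incl i₀ (z i₀) := by
    intro i
    by_cases hi : i = i₀
    · rw [hi]
    · obtain ⟨hadj, h1⟩ := hv i i₀ hi
      obtain ⟨-, h2⟩ := hv i₀ i (Ne.symm hi)
      simp only [z, map_pow, hincl]
      rw [← h1, ← h2]
      exact of_pow_eq hadj
  let f : PushoutI (cyclicHom z) →* TreeProduct T lam :=
    PushoutI.lift incl (zpowersHom _ (incl i₀ (z i₀))) fun i =>
      MonoidHom.ext_mint (by simp [hz i])
  have hf : ∀ i (x : {x | c x = i}), f (of i (PresentedGroup.of x)) = PresentedGroup.of (x : V) :=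
    fun i x => by rw [PushoutI.lift_of, hincl]
  let g : TreeProduct T lam →* PushoutI (cyclicHom z) :=
    TreeProduct.lift (fun x => of (c x) (PresentedGroup.of ⟨x, rfl⟩)) (by
      have hcongr : ∀ i x (hx : c x = i), (of (c x) (PresentedGroup.of ⟨x, rfl⟩) :
          PushoutI (cyclicHom z)) = of i (PresentedGroup.of ⟨x, hx⟩) := by
        rintro _ x rfl
        rfl
      intro x y hxy
      by_cases h : c x = c y
      · rw [hcongr (c y) x h, ← map_pow, ← map_pow]
        exact congrArg _ (of_pow_eq (T := T.induce {x | c x = c y}) (lam := fun x y => lam x y)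
          (a := ⟨x, h⟩) (b := ⟨y, rfl⟩) hxy)
      · obtain ⟨hx, hy⟩ := hc x y hxy h
        have hx' : (⟨x, rfl⟩ : {w | c w = c x}) = v (c x) := Subtype.ext hx
        have hy' : (⟨y, rfl⟩ : {w | c w = c y}) = v (c y) := Subtype.ext hy
        have h1 : lam x y = q (c x) := by
          rw [← (hv _ _ h).2, ← hx, ← hy]
        have h2 : lam y x = q (c y) := by
          rw [← (hv _ _ (Ne.symm h)).2, ← hx, ← hy]
        rw [hx', hy', h1, h2, hbase, hbase])
  have hg : ∀ i (x : {x | c x = i}), g (PresentedGroup.of (x : V)) =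
      of i (PresentedGroup.of x) := by
    rintro _ ⟨x, rfl⟩
    exact TreeProduct.lift_of _ _ _
  have : Nonempty ι := ⟨i₀⟩
  refine ⟨MonoidHom.toMulEquiv f g ?_ ?_, hf⟩
  · refine PushoutI.hom_ext_nonempty fun i => PresentedGroup.ext fun x => ?_
    simp only [MonoidHom.comp_apply, MonoidHom.id_apply, hf, hg]
  · refine PresentedGroup.ext fun x => ?_
    simp only [MonoidHom.comp_apply, MonoidHom.id_apply]
    rw [hg (c x) ⟨x, rfl⟩, hf]

theorem garsideFamily_of_subsingleton [Subsingleton V] [Nonempty V] :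
    GarsideFamily (PresentedGroup.of : V → TreeProduct T lam) := by
  refine .of_subsingleton (PresentedGroup.closure_range_of _)
    ⟨TreeProduct.lift (fun _ => Multiplicative.ofAdd 1) fun a b hab =>
      absurd (Subsingleton.elim a b) hab.ne, fun v => ?_⟩
  rw [TreeProduct.lift_of]
  exact one_pos

/-- The vertices generate the tree product as a family of Garside type, by induction on the tree:
a tree product is the amalgam of the infinite cyclic group of a leaf and of the tree product of
the remaining tree. -/
theorem garsideFamily [Finite V] (hT : T.IsTree) (hlam : ∀ a b, T.Adj a b → 0 < lam a b) :
    GarsideFamily (PresentedGroup.of : V → TreeProduct T lam) := by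
  classical
  induction hn : Nat.card V using Nat.strong_induction_on generalizing V with
  | _ n ih =>
  have := Fintype.ofFinite V
  have hne : Nonempty V := hT.connected.nonempty
  rcases subsingleton_or_nontrivial V with hV | hV
  · exact garsideFamily_of_subsingleton
  obtain ⟨a, ha⟩ := hT.exists_vert_degree_one_of_nontrivial
  obtain ⟨b, hab, hb⟩ := SimpleGraph.degree_eq_one_iff_existsUnique_adj.1 ha
  let c : V → Bool := fun x => decide (x = a)
  let v : ∀ i, {x | c x = i} := fun i => match i with
    | true => ⟨a, by simp [c]⟩
    | false => ⟨b, by simpa [c] using hab.ne'⟩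
  let q : Bool → ℕ := fun i => if i then lam a b else lam b a
  have hfam : ∀ i, GarsideFamily (PresentedGroup.of :
      {x | c x = i} → Induced T lam {x | c x = i}) := by
    intro i
    cases i with
    | true =>
      have : Subsingleton {x | c x = true} := ⟨by
        rintro ⟨x, hx⟩ ⟨y, hy⟩
        simp only [c, Set.mem_ofPred_eq, decide_eq_true_eq] at hx hy
        exact Subtype.ext (hx.trans hy.symm)⟩
      have : Nonempty {x | c x = true} := ⟨v true⟩
      exact garsideFamily_of_subsingleton
    | false =>
      have hs : {x | c x = false} = {a}ᶜ := by
        ext x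
        simp [c]
      refine ih _ ?_ ⟨?_, hT.isAcyclic.induce _⟩ (fun x y hxy => hlam _ _ hxy) rfl
      · rw [← hn]
        exact Finite.card_subtype_lt (x := a) (by simp [c])
      · rw [hs]
        exact hT.connected.induce_compl_singleton_of_degree_eq_one ha
  have hq : ∀ i, 0 < q i := by
    intro i
    cases i
    · exact hlam _ _ hab.symm
    · exact hlam _ _ hab
  obtain ⟨f, hf⟩ := nonempty_mulEquiv_pushoutI (T := T) (lam := lam) c v q
    (by
      intro i j hij
      cases i <;> cases j
      · exact absurd rfl hij
      · exact ⟨hab.symm, rfl⟩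
      · exact ⟨hab, rfl⟩
      · exact absurd rfl hij)
    (by
      intro x y hxy hne
      by_cases hx : x = a
      · subst hx
        have : y = b := hb y hxy
        subst this
        have h1 : c x = true := by simp [c]
        have h2 : c y = false := by simpa [c] using hab.ne'
        rw [h1, h2]
        exact ⟨rfl, rfl⟩
      · have hy : y = a := by
          by_contra hy
          exact hne (by simp [c, hx, hy])
        subst hy
        have : x = b := hb x hxy.symm
        subst this
        have h1 : c y = true := by simp [c]
        have h2 : c x = false := by simpa [c] using hab.ne'
        rw [h1, h2]
        exact ⟨rfl, rfl⟩)
  exact (GarsideFamily.amalgam hfam v hq).of_mulEquiv f (fun x => ⟨c x, x, rfl⟩)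
    (by rintro ⟨_, x, rfl⟩; exact ⟨x, rfl⟩) (fun x => hf _ _)

end TreeProduct

end TreeProducts

/-! ### Garside monoids from generating families of Garside type -/

section GarsideMonoids

variable {V G : Type u} [Group G] {e : V → G}

theorem isLeftDivisor_iff {M : Submonoid G} {x y : M} :
    IsLeftDivisor x y ↔ (x : G)⁻¹ * y ∈ M := by
  constructor
  · rintro ⟨w, rfl⟩
    simp
  · exact fun h => ⟨⟨_, h⟩, Subtype.ext (by simp)⟩

theorem isRightDivisor_iff {M : Submonoid G} {x y : M} :
    IsRightDivisor x y ↔ (y : G) * (x : G)⁻¹ ∈ M := by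
  constructor
  · rintro ⟨w, rfl⟩
    simp
  · exact fun h => ⟨⟨_, h⟩, Subtype.ext (by simp)⟩

theorem HasJoins.exists_isRightLcm {M : Submonoid G} (h : HasJoins M) (x y : M) :
    ∃ c : M, IsRightLcm x y c := by
  obtain ⟨c, hc⟩ := h x x.2 y y.2
  have hcM : c ∈ M := by simpa using M.mul_mem x.2 hc.left
  refine ⟨⟨c, hcM⟩, isLeftDivisor_iff.2 hc.left, isLeftDivisor_iff.2 hc.right, fun m hx hy => ?_⟩
  exact isLeftDivisor_iff.2 (hc.least m (isLeftDivisor_iff.1 hx) (isLeftDivisor_iff.1 hy))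

/-- An involutive anti-automorphism of the group that preserves the submonoid exchanges right and
left lcms. -/
theorem HasJoins.exists_isLeftLcm {M : Submonoid G} (h : HasJoins M) (r : G →* Gᵐᵒᵖ)
    (hr : ∀ x, (r (r x).unop).unop = x) (hrM : ∀ x ∈ M, (r x).unop ∈ M) (x y : M) :
    ∃ c : M, IsLeftLcm x y c := by
  obtain ⟨c, h1, h2, h3⟩ := h.exists_isRightLcm ⟨_, hrM x x.2⟩ ⟨_, hrM y y.2⟩
  have key : ∀ a b : M, IsRightDivisor a b ↔
      IsLeftDivisor (⟨_, hrM a a.2⟩ : M) ⟨_, hrM b b.2⟩ := by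
    intro a b
    rw [isLeftDivisor_iff, isRightDivisor_iff]
    constructor
    · intro hab
      simpa using hrM _ hab
    · intro hab
      simpa [hr] using hrM _ hab
  have hc : (⟨_, hrM _ (hrM c c.2)⟩ : M) = c := Subtype.ext (hr c)
  refine ⟨⟨_, hrM c c.2⟩, ?_, ?_, fun m hx hy => ?_⟩
  · rwa [key, hc]
  · rwa [key, hc]
  · rw [key, hc]
    exact h3 _ ((key _ _).1 hx) ((key _ _).1 hy)

/-- The submonoid generated by a finite family of Garside type is a Garside monoid, whose Garside
element is the common power of the generators. -/
theorem GarsideFamily.isGarsideMonoid [Finite V] [Nonempty V] (h : GarsideFamily e)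
    (r : G →* Gᵐᵒᵖ) (hr : ∀ v, r (e v) = MulOpposite.op (e v)) :
    IsGarsideMonoid (Submonoid.closure (Set.range e)) := by
  obtain ⟨W, hW⟩ := h.exists_weight
  obtain ⟨δ, hδ⟩ := h.exists_common_pow
  have hrr : ∀ x, (r (r x).unop).unop = x := by
    intro x
    have hx : x ∈ Subgroup.closure (Set.range e) := h.closure_eq_top ▸ Subgroup.mem_top x
    induction hx using Subgroup.closure_induction with
    | mem x hx => obtain ⟨v, rfl⟩ := hx; simp [hr]
    | one => simp
    | mul x y _ _ hx hy => simp [hx, hy]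
    | inv x _ hx => simp [hx]
  have hrM : ∀ x ∈ Submonoid.closure (Set.range e),
      (r x).unop ∈ Submonoid.closure (Set.range e) := by
    intro x hx
    induction hx using Submonoid.closure_induction with
    | mem x hx => obtain ⟨v, rfl⟩ := hx; simpa [hr] using subset_closure_range v
    | one => simp
    | mul x y _ _ hx hy => simpa using mul_mem hy hx
  refine ⟨?_, ?_, ?_, h.hasJoins.exists_isRightLcm, h.hasJoins.exists_isLeftLcm r hrr hrM, ?_⟩
  · rintro x ⟨⟨x, y, hxy, -⟩, rfl⟩
    by_contra hne
    have h1 := weight_pos_of_mem_closure hW x.2 (fun h1 => hne (Subtype.ext h1))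
    have h2 := weight_nonneg_of_mem_closure hW y.2
    have h3 : W ((x : G) * y) = 1 := by
      rw [← Submonoid.coe_mul, hxy, Submonoid.coe_one, map_one]
    rw [map_mul] at h3
    have := congrArg Multiplicative.toAdd h3
    rw [toAdd_mul, toAdd_one] at this
    omega
  · exact fun a b c => mul_left_cancel
  · exact fun a b c => mul_right_cancel
  have hδM : δ ∈ Submonoid.closure (Set.range e) := by
    obtain ⟨v⟩ := ‹Nonempty V›
    obtain ⟨n, -, rfl⟩ := hδ v
    exact pow_mem (subset_closure_range v) n
  refine ⟨⟨δ, hδM⟩, ?_, ?_, ?_⟩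
  · intro d
    rw [isLeftDivisor_iff, isRightDivisor_iff,
      (commute_of_common_pow h.closure_eq_top hδ (d : G)⁻¹).eq]
  · -- an element of weight at most `N` is a product of at most `N` generators
    have hword : ∀ x ∈ Submonoid.closure (Set.range e),
        ∃ l : List V, (l.map e).prod = x ∧ (l.length : ℤ) ≤ (W x).toAdd := by
      intro x hx
      induction hx using Submonoid.closure_induction_left with
      | one => exact ⟨[], by simp⟩
      | mul_left x hx y _ ih =>
        obtain ⟨v, rfl⟩ := hx
        obtain ⟨l, rfl, hl⟩ := ih
        refine ⟨v :: l, by simp, ?_⟩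
        have := hW v
        rw [map_mul, toAdd_mul, List.length_cons]
        push_cast
        omega
    refine Set.Finite.of_finite_image (f := Subtype.val) ?_ Subtype.val_injective.injOn
    refine ((List.finite_length_le V (W δ).toAdd.toNat).image fun l => (l.map e).prod).subset ?_
    rintro _ ⟨d, hd, rfl⟩
    obtain ⟨l, hl, hlen⟩ := hword d d.2
    refine ⟨l, ?_, hl⟩
    have := weight_nonneg_of_mem_closure hW (isLeftDivisor_iff.1 hd)
    rw [map_mul, map_inv, toAdd_mul, toAdd_inv] at this
    change l.length ≤ _
    simp only at this
    omega
  · rw [eq_top_iff, ← Submonoid.closure_closure_coe_preimage]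
    refine Submonoid.closure_mono ?_
    rintro ⟨_, hx⟩ ⟨v, rfl⟩
    obtain ⟨n, hn, hδn⟩ := hδ v
    obtain ⟨k, rfl⟩ := Nat.exists_eq_add_one.2 hn
    refine isLeftDivisor_iff.2 ?_
    simp only [← hδn]
    rw [pow_succ', inv_mul_cancel_left]
    exact pow_mem (subset_closure_range v) k

/-- The canonical homomorphism from a monoid to its enveloping group. -/
def EnvelopingGroup.ofHom (M : Type u) [Monoid M] : M →* EnvelopingGroup M :=
  have hmul : ∀ a b : M, (PresentedGroup.of (a * b) : EnvelopingGroup M) =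
      PresentedGroup.of a * PresentedGroup.of b := fun a b => by
    have hrel : FreeGroup.of a * FreeGroup.of b * (FreeGroup.of (a * b))⁻¹ ∈
        {r : FreeGroup M | ∃ b c d : M, b * c = d ∧
          r = FreeGroup.of b * FreeGroup.of c * (FreeGroup.of d)⁻¹} :=
      ⟨a, b, a * b, rfl, rfl⟩
    exact (PresentedGroup.mk_eq_mk_of_mul_inv_mem hrel).symm
  { toFun := PresentedGroup.of
    map_one' := by simpa using hmul 1 1
    map_mul' := hmul }

/-- The universal property of the enveloping group. -/
def EnvelopingGroup.lift {M : Type u} [Monoid M] {K : Type*} [Group K] (f : M →* K) :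
    EnvelopingGroup M →* K :=
  have hrel : ∀ r ∈ {r : FreeGroup M | ∃ b c d : M, b * c = d ∧
      r = FreeGroup.of b * FreeGroup.of c * (FreeGroup.of d)⁻¹}, FreeGroup.lift f r = 1 := by
    rintro _ ⟨b, c, _, rfl, rfl⟩
    simp
  PresentedGroup.toGroup hrel

@[simp]
theorem EnvelopingGroup.lift_of {M : Type u} [Monoid M] {K : Type*} [Group K] (f : M →* K)
    (x : M) : EnvelopingGroup.lift f (PresentedGroup.of x) = f x :=
  FreeGroup.lift_apply_of

namespace TreeProduct

variable (T : SimpleGraph V) (lam : V → V → ℕ)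

/-- The submonoid of a tree product generated by the vertices. -/
abbrev positiveCone : Submonoid (TreeProduct T lam) :=
  Submonoid.closure (Set.range PresentedGroup.of)

/-- A tree product is the enveloping group of its positive cone, because the defining
relations of the tree product are relations between positive elements. -/
theorem nonempty_mulEquiv_envelopingGroup :
    Nonempty (TreeProduct T lam ≃* EnvelopingGroup (positiveCone T lam)) := by
  let gen : V → positiveCone T lam := fun v => ⟨PresentedGroup.of v, subset_closure_range v⟩
  let f : TreeProduct T lam →* EnvelopingGroup (positiveCone T lam) :=
    TreeProduct.lift (fun v => EnvelopingGroup.ofHom _ (gen v)) fun a b hab => by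
      rw [← map_pow, ← map_pow]
      exact congrArg _ (Subtype.ext (of_pow_eq hab))
  let g : EnvelopingGroup (positiveCone T lam) →* TreeProduct T lam :=
    EnvelopingGroup.lift (positiveCone T lam).subtype
  have hf : ∀ x (hx : x ∈ positiveCone T lam), f x = EnvelopingGroup.ofHom _ ⟨x, hx⟩ := by
    intro x hx
    induction hx using Submonoid.closure_induction with
    | mem x hx =>
      obtain ⟨v, rfl⟩ := (hx : x ∈ Set.range (PresentedGroup.of : V → TreeProduct T lam))
      exact TreeProduct.lift_of _ _ _
    | one => rw [map_one]; exact (map_one _).symm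
    | mul x y hx hy ihx ihy => rw [map_mul, ihx, ihy, ← map_mul]; rfl
  refine ⟨MonoidHom.toMulEquiv f g ?_ ?_⟩
  · refine PresentedGroup.ext fun v => ?_
    rw [MonoidHom.comp_apply, TreeProduct.lift_of]
    exact EnvelopingGroup.lift_of _ _
  · refine PresentedGroup.ext fun x => ?_
    rw [MonoidHom.comp_apply, EnvelopingGroup.lift_of, Submonoid.subtype_apply,
      hf x x.2]
    rfl

end TreeProduct

end GarsideMonoids

theorem corollaryc {V : Type u} [Finite V] (T : SimpleGraph V) (hT : T.IsTree)
    (lam : V → V → ℕ) (hlam : ∀ a b : V, T.Adj a b → 2 ≤ lam a b) :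
    IsGarsideGroup (TreeProduct T lam) := by
  have : Nonempty V := hT.connected.nonempty
  have h : GarsideFamily (PresentedGroup.of : V → TreeProduct T lam) :=
    TreeProduct.garsideFamily hT fun a b hab => lt_of_lt_of_le two_pos (hlam a b hab)
  refine ⟨TreeProduct.positiveCone T lam, inferInstance, ?_,
    TreeProduct.nonempty_mulEquiv_envelopingGroup T lam⟩
  refine h.isGarsideMonoid
    (TreeProduct.lift (fun v => MulOpposite.op (PresentedGroup.of v)) fun a b hab => ?_)
    fun v => TreeProduct.lift_of _ _ _
  rw [← MulOpposite.op_pow, ← MulOpposite.op_pow, TreeProduct.of_pow_eq hab]
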